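/- **Setting.** Let $-\infty<a<b<\infty$ and let $J$ be an index set. For each $j\in J$ let $N_j\ge 2$, let $S^{(j)}_i(x)=r^{(j)}_i x+c^{(j)}_i$ $(1\le i\le N_j)$ with $r_i^{(j)}\in(0,1)$, $c_i^{(j)}\in\mathbb R$ and $$a=S^{(j)}_1(a)<S^{(j)}_1(b)\le S^{(j)}_2(a)<S_2^{(j)}(b)\le\dots\le S^{(j)}_{N_j}(a)<S^{(j)}_{N_j}(b)=b,$$ and let $m^{(j)}=(m^{(j)}_1,\dots,m^{(j)}_{N_j})$ be positive weights with sum $1$. Assume that $\sup_j N_j<\infty$ and that all the numbers $m^{(j)}_i$, and likewise all the numbers $r^{(j)}_i$, lie in a compact subinterval of $(0,1)$. Let $V\in\mathbb N$. An environment $E$ assigns to each type $v\in\{1,\dots,V\}$ an index $j^E_v\in J$ and types $\tau^E_{v,1},\dots,\tau^E_{v,N_{j^E_v}}\in\{1,\dots,V\}$; it is a *neck* if all the $\tau^E_{v,i}$ are equal. A $V$-variable tree $I$ is given by a type $\tau^\emptyset$ of the ancestor $\emptyset$ and a sequence $(E^n)_{n\ge1}$ of environments: an individual $\mathbf i$ of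 generation $n$ and of type $v$ carries the index $j_v^{E^{n+1}}$, which we also denote by $\mathbf i$; it has $N_{\mathbf i}$ children, and its $i$-th child has type $\tau^{E^{n+1}}_{v,i}$. For $\mathbf i=(i_1,\dots,i_n)\in I$ let $|\mathbf i|=n$, $\mathbf i|_l=(i_1,\dots,i_l)$, $r_{\mathbf i}=r^{(\emptyset)}_{i_1}r^{(\mathbf i|_1)}_{i_2}\cdots r^{(\mathbf i|_{n-1})}_{i_n}$, let $m_{\mathbf i}$ be defined likewise, let $S_{\mathbf i}=S^{(\emptyset)}_{i_1}\circ\cdots\circ S^{(\mathbf i|_{n-1})}_{i_n}$, and let $\theta_{\mathbf i}I$ be the subtree rooted at $\mathbf i$. Let $\mu^{(I)}$ be the weak limit, as $n\to\infty$, of $\mu^{(I)}_n=\sum_{|\mathbf i|=n}m_{\mathbf i}\,\mu_0\circ S_{\mathbf i}^{-1}$, where $\mu_0$ is the normalized Lebesgue measure on $[a,b]$. Assume that $E^n$ is a neck for infinitely many $n$; let $n(1)<n(2)<\dots$ be these $n$, and $n(0)=0$. Put $\Lambda_0=\{\emptyset\}$ and, for $k\ge1$, $$\Lambda_k=\bigl\{\mathbf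 i\in I:\ \exists\, l\ge1,\ |\mathbf i|=n(l),\ m_{\mathbf i}r_{\mathbf i}\le e^{-k}<m_{\mathbf i|_{n(l-1)}}\,r_{\mathbf i|_{n(l-1)}}\bigr\}.$$ **Forms.** Elements of $H^1(u,v)$ are represented by functions that are continuous on the open interval $(u,v)$; their values at $u$ and $v$ play no role. Let $\mathcal F=H^1(a,b)$ and $\mathcal E(f,g)=\int_a^b f'g'\,dx$. For $\mathbf i\in\Lambda_k$ with $S_{\mathbf i}(b)\ne b$ let $I_{\mathbf i}=(S_{\mathbf i}(b),S_{\mathbf i'}(a))$ be the (possibly empty) gap between the cell $S_{\mathbf i}([a,b])$ and the next cell $S_{\mathbf i'}([a,b])$, $\mathbf i'\in\Lambda_k$, to its right. Let $\mathcal F^k$ be the set of the functions $f$ with $f\circ S_{\mathbf i}\in H^1(a,b)$ for all $\mathbf i\in\Lambda_k$ and $f|_{I_{\mathbf i}}\in H^1(I_{\mathbf i})$ for all $\mathbf i\in\Lambda_k$ with $S_{\mathbf i}(b)\neq b$; no continuity between adjacent cells or gaps is required. Let $$\mathcal E^k(f,g)=\sum_{\mathbf i\in\Lambda_k}\frac1{r_{\mathbf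 i}}\,\mathcal E(f\circ S_{\mathbf i},g\circ S_{\mathbf i})+\sum_{\mathbf i\in\Lambda_k,\ S_{\mathbf i}(b)\ne b}\ \int_{I_{\mathbf i}}f'g'\,dx .$$ For a form $(\mathcal A,\mathcal D)$ on $L^2(\mu)$, the eigenspace for $\lambda\in\mathbb R$ is the set of the classes in $L^2(\mu)$ of those $f\in\mathcal D$ with $\mathcal A(f,g)=\lambda\langle f,g\rangle_{L^2(\mu)}$ for all $g\in\mathcal D$; $\lambda$ is an eigenvalue if this space is not $\{0\}$, its dimension is the multiplicity of $\lambda$, and the eigenvalue counting function at $x$ is the number of the eigenvalues $\le x$, counted with multiplicity. Let $N_N^{(I)}$ be the counting function of $(\mathcal E,\mathcal F)$ on $L^2(\mu^{(I)})$ (so that $N_N^{(\theta_{\mathbf i}I)}$ is that of $(\mathcal E,\mathcal F)$ on $L^2(\mu^{(\theta_{\mathbf i}I)})$), and $N_N^k$ that of $(\mathcal E^k,\mathcal F^k)$ on $L^2(\mu^{(I)})$. **Proposition 4.6.** For all $x\ge0$ and all $k\in\mathbb N_0$, $$N_N^k(x)=\sum_{\mathbf i\in\Lambda_k}N_N^{(\theta_{\mathbf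 i}I)}\bigl(r_{\mathbf i}\,m_{\mathbf i}\,x\bigr).$$ -/

import Mathlib

open Set MeasureTheory Filter Topology

/-- An iterated function system `S_i x = r_i x + c_i` on `[a, b]` with `N ≥ 2` maps, whose cells
`S_i [a, b]` are ordered from left to right, do not overlap, and contain `a` and `b`,
together with a vector `m` of positive weights of total mass one.  Indices start at `0`. -/
structure WeightedIFS (a b : ℝ) where
  N : ℕ
  two_le : 2 ≤ N
  r : Fin N → ℝ
  c : Fin N → ℝ
  m : Fin N → ℝ
  r_pos : ∀ i, 0 < r i
  r_lt_one : ∀ i, r i < 1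
  left_end : r ⟨0, by omega⟩ * a + c ⟨0, by omega⟩ = a
  right_end : r ⟨N - 1, by omega⟩ * b + c ⟨N - 1, by omega⟩ = b
  ordered : ∀ i j, i < j → r i * b + c i ≤ r j * a + c j
  m_pos : ∀ i, 0 < m i
  m_sum : ∑ i, m i = 1

/-- The contraction `S_i`. -/
def WeightedIFS.map {a b : ℝ} (s : WeightedIFS a b) (i : Fin s.N) (x : ℝ) : ℝ :=
  s.r i * x + s.c i

/-- An environment: every type `v` receives an index `idx v ∈ J` and, for each map of the
corresponding system, a type `typ v i`. -/
structure Environment {J : Type*} {a b : ℝ} (ifs : J → WeightedIFS a b) (V : ℕ) where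
  idx : Fin V → J
  typ : ∀ v, Fin (ifs (idx v)).N → Fin V

/-- An environment is a neck if all the types that it assigns are equal. -/
def Environment.IsNeck {J : Type*} {a b : ℝ} {ifs : J → WeightedIFS a b} {V : ℕ}
    (E : Environment ifs V) : Prop :=
  ∀ v i v' i', E.typ v i = E.typ v' i'

/-- A `V`-variable tree: the type of the ancestor and the sequence of environments.
`env n` is the environment `E^{n+1}`: it gives the systems used by the individuals of
generation `n` and the types of the individuals of generation `n + 1`. -/
structure VTree {J : Type*} {a b : ℝ} (ifs : J → WeightedIFS a b) (V : ℕ) where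
  rootType : Fin V
  env : ℕ → Environment ifs V

namespace VTree

variable {J : Type*} {a b : ℝ} {ifs : J → WeightedIFS a b} {V : ℕ}

/-- The weighted system attached to the ancestor. -/
def sys (I : VTree ifs V) : WeightedIFS a b := ifs ((I.env 0).idx I.rootType)

/-- The subtree rooted at the `i`-th child of the ancestor. -/
def child (I : VTree ifs V) (i : Fin I.sys.N) : VTree ifs V where
  rootType := (I.env 0).typ I.rootType i
  env n := I.env (n + 1)

/-- The individuals of the tree: `cons i w` is the individual `(i, w₁, …, w_n)`, where
`w = (w₁, …, w_n)` is an individual of the subtree rooted at the `i`-th child. -/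
inductive Node : VTree ifs V → Type _
  | root (I : VTree ifs V) : Node I
  | cons {I : VTree ifs V} (i : Fin I.sys.N) (w : Node (I.child i)) : Node I

namespace Node

/-- The generation of an individual. -/
def length : {I : VTree ifs V} → Node I → ℕ
  | _, root _ => 0
  | _, cons _ w => w.length + 1

/-- The ancestor of an individual in generation `n` (the individual itself if its generation
is at most `n`). -/
def take : {I : VTree ifs V} → ℕ → Node I → Node I
  | I, 0, _ => root I
  | I, _ + 1, root _ => root I
  | _, n + 1, cons i w => cons i (w.take n)

/-- The product of the contraction ratios along the path from the ancestor to `w`. -/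
noncomputable def scale : {I : VTree ifs V} → Node I → ℝ
  | _, root _ => 1
  | I, cons i w => I.sys.r i * w.scale

/-- The product of the weights along the path from the ancestor to `w`. -/
noncomputable def weight : {I : VTree ifs V} → Node I → ℝ
  | _, root _ => 1
  | I, cons i w => I.sys.m i * w.weight

/-- The composition of the contractions along the path from the ancestor to `w`. -/
noncomputable def map : {I : VTree ifs V} → Node I → ℝ → ℝ
  | _, root _ => id
  | I, cons i w => I.sys.map i ∘ w.map

/-- The subtree rooted at `w`. -/
def subtree : {I : VTree ifs V} → Node I → VTree ifs V
  | I, root _ => I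
  | _, cons _ w => w.subtree

/-- `w` is the last individual of its generation: it is reached by always passing to the
last child. -/
def IsLast : {I : VTree ifs V} → Node I → Prop
  | _, root _ => True
  | I, cons i w => (i : ℕ) + 1 = I.sys.N ∧ w.IsLast

/-- The set of the individuals of generation `n`. -/
def level : (n : ℕ) → (I : VTree ifs V) → Finset (Node I)
  | 0, I => {root I}
  | n + 1, I =>
    ((Finset.univ : Finset (Fin I.sys.N)).sigma fun i => level n (I.child i)).map
      ⟨fun p => cons p.1 p.2, by
        rintro ⟨i, v⟩ ⟨j, w⟩ h
        simp only [cons.injEq] at h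
        obtain ⟨rfl, h⟩ := h
        rw [eq_of_heq h]⟩

theorem mem_level {I : VTree ifs V} (w : Node I) : ∀ n, w ∈ level n I ↔ w.length = n := by
  induction w with
  | root I => intro n; cases n <;> simp [level, length]
  | cons i w ih =>
    intro n
    cases n with
    | zero => simp [level, length]
    | succ n =>
      simp only [level, length, Finset.mem_map, Finset.mem_sigma, Finset.mem_univ, true_and,
        Nat.add_right_cancel_iff]
      constructor
      · rintro ⟨⟨j, v⟩, hv, h⟩
        replace h : cons j v = cons i w := h
        simp only [cons.injEq] at h
        obtain ⟨rfl, h⟩ := h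
        exact (ih n).1 (eq_of_heq h ▸ hv)
      · intro h
        exact ⟨⟨i, w⟩, (ih n).2 h, rfl⟩

end Node

/-- The `l`-th neck level of the tree, with the convention that the `0`-th one is `0`. The level
`n + 1` is a neck if the environment that determines the types of generation `n + 1` is one. -/
noncomputable def neckLevel (I : VTree ifs V) : ℕ → ℕ
  | 0 => 0
  | l + 1 => Nat.nth (fun n => (I.env n).IsNeck) l + 1

/-- The cut sets `Λ_k`. -/
noncomputable def cutSet (I : VTree ifs V) (k : ℕ) : Set (Node I) :=
  if k = 0 then {Node.root I} else
    {w | ∃ l : ℕ, w.length = I.neckLevel (l + 1) ∧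
      w.weight * w.scale ≤ Real.exp (-k) ∧
      Real.exp (-k) < (w.take (I.neckLevel l)).weight * (w.take (I.neckLevel l)).scale}

end VTree

/-- The normalized Lebesgue measure on `[a, b]`. -/
noncomputable def baseMeasure (a b : ℝ) : FiniteMeasure ℝ :=
  let ν : FiniteMeasure ℝ := ⟨volume.restrict (Icc a b), inferInstance⟩
  (Real.toNNReal (b - a))⁻¹ • ν

namespace VTree

variable {J : Type*} {a b : ℝ} {ifs : J → WeightedIFS a b} {V : ℕ}

/-- The `n`-th approximation `μ_n = ∑_{|w| = n} m_w μ₀ ∘ S_w⁻¹` of the Cantor measure. -/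
noncomputable def approxMeasure (I : VTree ifs V) (n : ℕ) : FiniteMeasure ℝ :=
  ∑ w ∈ Node.level n I, Real.toNNReal w.weight • (baseMeasure a b).map w.map

/-- The Cantor measure of the tree: the weak limit of its approximations (the topology of
`FiniteMeasure ℝ` is that of weak convergence). -/
noncomputable def cantorMeasure (I : VTree ifs V) : Measure ℝ :=
  ((limUnder atTop I.approxMeasure : FiniteMeasure ℝ) : Measure ℝ)

end VTree

/-! ### Forms and their eigenvalue counting functions -/

/-- Let `E` be a bilinear form on a space `F` of functions.  The eigenspace of `(E, F)` on
`L²(μ)` for `lam`: it consists of the classes in `L²(μ)` of the functions `f ∈ F` with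
`E f g = lam ⟨f, g⟩` for all `g ∈ F`.  (For the forms below these classes already form a linear
subspace.  Functions of `F` that agree `μ`-almost everywhere are identified, so that a
function that vanishes `μ`-almost everywhere is never an eigenfunction.) -/
noncomputable def formEigenspace (F : Set (ℝ → ℝ)) (E : (ℝ → ℝ) → (ℝ → ℝ) → ℝ) (μ : Measure ℝ)
    (lam : ℝ) : Submodule ℝ (Lp ℝ 2 μ) :=
  Submodule.span ℝ {φ | ∃ f ∈ F, φ =ᵐ[μ] f ∧ ∀ g ∈ F, E f g = lam * ∫ x, f x * g x ∂μ}

/-- The eigenvalue counting function of `(E, F)` on `L²(μ)`: the number of eigenvalues `≤ x`,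
counted with their multiplicities. -/
noncomputable def formCount (F : Set (ℝ → ℝ)) (E : (ℝ → ℝ) → (ℝ → ℝ) → ℝ) (μ : Measure ℝ)
    (x : ℝ) : ℕ∞ :=
  ∑' lam : Iic x, Cardinal.toENat (Module.rank ℝ (formEigenspace F E μ lam))

/-- `f` is, on the open interval `(u, v)`, the continuous representative of an element of the
Sobolev space `H¹(u, v)`: it is there a primitive of a square integrable function. The values of
`f` at `u` and `v` play no role. -/
def MemH1 (u v : ℝ) (f : ℝ → ℝ) : Prop :=
  ∃ g : ℝ → ℝ, MemLp g 2 (volume.restrict (Ioo u v)) ∧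
    ∀ s ∈ Ioo u v, ∀ t ∈ Ioo u v, f t - f s = ∫ y in s..t, g y

/-- `∫_u^v f' g' dx`. (An element of `H¹` is differentiable almost everywhere, and its
derivative there is its weak derivative.) -/
noncomputable def energy (u v : ℝ) (f g : ℝ → ℝ) : ℝ :=
  ∫ x in Ioo u v, deriv f x * deriv g x

namespace VTree

variable {J : Type*} {a b : ℝ} {ifs : J → WeightedIFS a b} {V : ℕ}

/-- The Neumann eigenvalue counting function `N_N^{(I)}`: that of the form
`∫_a^b f' g' dx` with domain `H¹(a, b)`, on `L²(μ^{(I)})`. -/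
noncomputable def neumannCount (I : VTree ifs V) (x : ℝ) : ℕ∞ :=
  formCount {f | MemH1 a b f} (energy a b) I.cantorMeasure x

/-- The left end point of the first cell `S_{w'} [a, b]`, `w' ∈ Λ`, to the right of the cell
`S_w [a, b]`. -/
noncomputable def nextLeft {I : VTree ifs V} (Λ : Set (Node I)) (w : Node I) : ℝ :=
  sInf {y | ∃ w' ∈ Λ, y = w'.map a ∧ w.map b ≤ y}

/-- The domain of the decoupled form: `H¹` on each cell `S_w [a, b]`, `w ∈ Λ`, and on each (possibly
empty) gap `(S_w b, S_{w'} a)` between consecutive cells. -/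
def decoupledDomain {I : VTree ifs V} (Λ : Set (Node I)) : Set (ℝ → ℝ) :=
  {f | (∀ w ∈ Λ, MemH1 a b (f ∘ w.map)) ∧
    ∀ w ∈ Λ, ¬ w.IsLast → MemH1 (w.map b) (nextLeft Λ w) f}

/-- The decoupled form. -/
noncomputable def decoupledForm {I : VTree ifs V} (Λ : Set (Node I)) (f g : ℝ → ℝ) : ℝ :=
  (∑' w : Λ, 1 / w.1.scale * energy a b (f ∘ w.1.map) (g ∘ w.1.map)) +
    ∑' w : {w : Node I // w ∈ Λ ∧ ¬ w.IsLast}, energy (w.1.map b) (nextLeft Λ w.1) f g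

/-- The counting function `N_N^k` of the form decoupled along the cut set `Λ_k`,
on `L²(μ^{(I)})`. -/
noncomputable def decoupledCount (I : VTree ifs V) (k : ℕ) (x : ℝ) : ℕ∞ :=
  formCount (decoupledDomain (I.cutSet k)) (decoupledForm (I.cutSet k)) I.cantorMeasure x

end VTree

/-! ### Families of extended natural numbers and finite products of spans -/

/-! No matching is imposed between cells and gaps, so an element of the decoupled domain is a free
choice of one function per cell and per gap. Let `w` run through the cut. The measure satisfies `μ =
∑ m_w μ_w ∘ S_w⁻¹`, with `μ_w` the measure of the subtree at `w`, and `μ_w` does not charge `{a,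
b}`, so `μ` lives on the open cells.

Testing the eigenvalue equation with functions supported in one cell gives `(1 / r_w) E(f ∘ S_w, g)
= lam m_w ⟨f ∘ S_w, g⟩`: thus `f ∘ S_w` is an eigenfunction on the subtree for `r_w m_w lam`.
Conversely, eigenfunctions on the cells, extended by zero to the gaps, glue to an eigenfunction;
what happens on gaps is invisible in `L²(μ)`. Hence the eigenspace for `lam` is the product of those
for `r_w m_w lam`, dimensions add, and summing over `lam ≤ x` gives the formula in `ℕ∞`, with no
appeal to discreteness of the spectrum.

The linear algebra is `toENat_rank_formEigenspace_eq_sum`, the gluing `formCount_decoupled_eq_sum`.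
The tree enters through `isCut_cutSet` (the `Λ_k` are finite cuts), `IsCut.cantorMeasure_eq_finsum`
and `ae_mem_Ioo_cantorMeasure`. -/

theorem ENat.summable_of_any {α : Type*} (f : α → ℕ∞) : Summable f :=
  ⟨_, hasSum_of_isLUB _ (isLUB_iSup (f := fun s : Finset α => ∑ i ∈ s, f i))⟩

/-- Since `0 ∈ G i`, the box contains the vectors with a single nonzero coordinate taken from `G i`;
over a finite index set these already span the product. -/
theorem Submodule.span_univ_pi {R ι : Type*} [Semiring R] [Finite ι] {M : ι → Type*}
    [∀ i, AddCommMonoid (M i)] [∀ i, Module R (M i)] (G : ∀ i, Set (M i)) (h0 : ∀ i, 0 ∈ G i) :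
    Submodule.span R (Set.univ.pi G) = Submodule.pi Set.univ fun i => Submodule.span R (G i) := by
  classical
  apply le_antisymm
  · refine Submodule.span_le.2 fun x hx i hi => Submodule.subset_span (hx i hi)
  · rw [← Submodule.iSup_map_single, iSup_le_iff]
    intro i
    rw [Submodule.map_span, Submodule.span_le]
    rintro _ ⟨y, hy, rfl⟩
    refine Submodule.subset_span fun j _ => ?_
    by_cases h : j = i
    · subst h; simpa using hy
    · simpa [Pi.single_eq_of_ne h] using h0 j

theorem Cardinal.toENat_sum_of_finite {ι : Type*} [Fintype ι] (f : ι → Cardinal) :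
    Cardinal.toENat (Cardinal.sum f) = ∑ i, Cardinal.toENat (f i) := by
  refine Fintype.induction_empty_option (P := fun α _ => ∀ f : α → Cardinal,
    Cardinal.toENat (Cardinal.sum f) = ∑ i, Cardinal.toENat (f i)) ?_ ?_ ?_ ι f
  · intro α β _ e h f
    let _ := Fintype.ofEquiv β e.symm
    have h1 : Cardinal.sum f = Cardinal.sum fun a => f (e a) :=
      (Equiv.sigmaCongrLeft (β := fun b => Quotient.out (f b)) e).symm.cardinal_eq
    rw [h1, h]
    exact Fintype.sum_equiv e _ _ fun _ => rfl
  · intro f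
    have h1 : Cardinal.sum f = 0 := Cardinal.mk_eq_zero _
    simp [h1]
  · intro α _ h f
    let e : (Σ i : Option α, Quotient.out (f i)) ≃
        Quotient.out (f none) ⊕ Σ a, Quotient.out (f (some a)) :=
      { toFun := fun
          | ⟨none, x⟩ => Sum.inl x
          | ⟨some a, x⟩ => Sum.inr ⟨a, x⟩
        invFun := Sum.elim (fun x => ⟨none, x⟩) fun y => ⟨some y.1, y.2⟩
        left_inv := by rintro ⟨_ | a, x⟩ <;> rfl
        right_inv := by rintro (x | ⟨a, x⟩) <;> rfl }
    have h1 : Cardinal.sum f = _ := e.cardinal_eq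
    rw [h1, Cardinal.mk_sum, map_add, Cardinal.toENat_lift, Cardinal.toENat_lift,
      Cardinal.mk_sigma, h, Fintype.sum_option]
    simp

/-- The product of submodules is linearly equivalent to the submodule `Submodule.pi univ p`. -/
def Submodule.univPiEquiv {R ι : Type*} [Semiring R] {M : ι → Type*}
    [∀ i, AddCommMonoid (M i)] [∀ i, Module R (M i)] (p : ∀ i, Submodule R (M i)) :
    Submodule.pi Set.univ p ≃ₗ[R] ∀ i, p i where
  toFun x i := ⟨x.1 i, x.2 i (Set.mem_univ i)⟩
  invFun y := ⟨fun i => y i, fun i _ => (y i).2⟩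
  map_add' _ _ := rfl
  map_smul' _ _ := rfl

/-- If an injective linear map sends a set `G` onto a finite product of sets `H i ∋ 0`, then the
dimension of the span of `G` is the sum of the dimensions of the spans of the `H i`. -/
theorem toENat_rank_span_eq_sum {ι : Type*} [Fintype ι] {M : Type*} [AddCommGroup M] [Module ℝ M]
    {M' : ι → Type*} [∀ i, AddCommGroup (M' i)] [∀ i, Module ℝ (M' i)]
    (T : M →ₗ[ℝ] ∀ i, M' i) (hT : Function.Injective T) (G : Set M) (H : ∀ i, Set (M' i))
    (h0 : ∀ i, 0 ∈ H i) (hGH : T '' G = Set.univ.pi H) :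
    Cardinal.toENat (Module.rank ℝ (Submodule.span ℝ G)) =
      ∑ i, Cardinal.toENat (Module.rank ℝ (Submodule.span ℝ (H i))) := by
  have e := Submodule.equivMapOfInjective T hT (Submodule.span ℝ G)
  rw [Submodule.map_span, hGH, Submodule.span_univ_pi H h0] at e
  have := congrArg Cardinal.toENat (e.trans (Submodule.univPiEquiv _)).lift_rank_eq
  rwa [Cardinal.toENat_lift, Cardinal.toENat_lift, rank_pi, Cardinal.toENat_sum_of_finite] at this

/-! ### Eigenfunctions of forms -/

/-- The function `f` belongs to `F` and is an eigenfunction (or zero) of `E` for `lam`. -/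
def IsFormEigenfunction (F : Set (ℝ → ℝ)) (E : (ℝ → ℝ) → (ℝ → ℝ) → ℝ) (μ : Measure ℝ)
    (lam : ℝ) (f : ℝ → ℝ) : Prop :=
  f ∈ F ∧ ∀ g ∈ F, E f g = lam * ∫ x, f x * g x ∂μ

theorem formEigenspace_eq_span (F : Set (ℝ → ℝ)) (E : (ℝ → ℝ) → (ℝ → ℝ) → ℝ) (μ : Measure ℝ)
    (lam : ℝ) : formEigenspace F E μ lam =
      Submodule.span ℝ {φ : Lp ℝ 2 μ | ∃ f, IsFormEigenfunction F E μ lam f ∧ φ =ᵐ[μ] f} := by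
  unfold formEigenspace IsFormEigenfunction
  congr 1
  ext φ
  constructor
  · rintro ⟨f, hf, h, hg⟩; exact ⟨f, ⟨hf, hg⟩, h⟩
  · rintro ⟨f, ⟨hf, hg⟩, h⟩; exact ⟨f, hf, h, hg⟩

/-- Composition with a measurable map `S` as an operator from `L²(μ)` to `L²(ν)`, when `ν ∘ S⁻¹` is
at most a multiple of `μ`. -/
noncomputable def Lp.compOfMapLeSMul {μ ν : Measure ℝ} {S : ℝ → ℝ} (hS : Measurable S)
    {c : ENNReal} (hc : c ≠ ⊤) (h : ν.map S ≤ c • μ) : Lp ℝ 2 μ →ₗ[ℝ] Lp ℝ 2 ν where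
  toFun φ := (((Lp.memLp φ).of_measure_le_smul hc h).comp_of_map hS.aemeasurable).toLp _
  map_add' φ ψ := by
    rw [← MemLp.toLp_add]
    apply MemLp.toLp_congr
    have : ∀ᵐ x ∂(ν.map S), (φ + ψ : Lp ℝ 2 μ) x = φ x + ψ x :=
      (Measure.absolutelyContinuous_of_le_smul h).ae_le (Lp.coeFn_add φ ψ)
    exact ae_of_ae_map hS.aemeasurable this
  map_smul' r φ := by
    rw [RingHom.id_apply, ← MemLp.toLp_const_smul]
    apply MemLp.toLp_congr
    have : ∀ᵐ x ∂(ν.map S), (r • φ : Lp ℝ 2 μ) x = r • φ x :=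
      (Measure.absolutelyContinuous_of_le_smul h).ae_le (Lp.coeFn_smul r φ)
    exact ae_of_ae_map hS.aemeasurable this

theorem Lp.coeFn_compOfMapLeSMul {μ ν : Measure ℝ} {S : ℝ → ℝ} (hS : Measurable S)
    {c : ENNReal} (hc : c ≠ ⊤) (h : ν.map S ≤ c • μ) (φ : Lp ℝ 2 μ) :
    Lp.compOfMapLeSMul hS hc h φ =ᵐ[ν] φ ∘ S :=
  (((Lp.memLp φ).of_measure_le_smul hc h).comp_of_map hS.aemeasurable).coeFn_toLp

section Decoupling

variable {ι : Type*} [Fintype ι] {S : ι → ℝ → ℝ} {μ : Measure ℝ} {ν : ι → Measure ℝ}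
  {p : ι → ENNReal}

theorem ae_of_forall_ae_comp (hS : ∀ i, MeasurableEmbedding (S i))
    (hμ : μ = ∑ i, p i • (ν i).map (S i)) {P : ℝ → Prop} (h : ∀ i, ∀ᵐ x ∂(ν i), P (S i x)) :
    ∀ᵐ x ∂μ, P x := by
  rw [hμ, ae_finsetSum_measure_iff]
  intro i _
  exact Measure.ae_smul_measure ((hS i).ae_map_iff.2 (h i)) _

/-- This domination is what makes `φ ↦ φ ∘ S i` well defined from classes in `L²(μ)` to classes in
`L²(ν i)`. -/
theorem map_le_inv_smul (hp : ∀ i, p i ≠ 0) (hp' : ∀ i, p i ≠ ⊤)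
    (hμ : μ = ∑ i, p i • (ν i).map (S i)) (i : ι) : (ν i).map (S i) ≤ (p i)⁻¹ • μ := by
  classical
  have : p i • (ν i).map (S i) ≤ μ := by
    rw [hμ, ← Finset.add_sum_erase _ _ (Finset.mem_univ i)]
    exact Measure.le_add_right le_rfl
  calc (ν i).map (S i) = (p i)⁻¹ • p i • (ν i).map (S i) := by
        rw [smul_smul, ENNReal.inv_mul_cancel (hp i) (hp' i), one_smul]
    _ ≤ _ := by gcongr

/-- If the measure `μ` is a combination of images of measures `ν i` and the eigenfunctions of a form
on `L²(μ)` are obtained by freely combining eigenfunctions of forms on the spaces `L²(ν i)`, then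
the multiplicities add up. -/
theorem toENat_rank_formEigenspace_eq_sum (hS : ∀ i, MeasurableEmbedding (S i))
    (hp : ∀ i, p i ≠ 0) (hp' : ∀ i, p i ≠ ⊤) (hμ : μ = ∑ i, p i • (ν i).map (S i))
    {F : Set (ℝ → ℝ)} {E : (ℝ → ℝ) → (ℝ → ℝ) → ℝ} {lam : ℝ}
    {F' : ι → Set (ℝ → ℝ)} {E' : ι → (ℝ → ℝ) → (ℝ → ℝ) → ℝ} {lam' : ι → ℝ}
    (h0 : ∀ i, IsFormEigenfunction (F' i) (E' i) (ν i) (lam' i) 0)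
    (hres : ∀ f, IsFormEigenfunction F E μ lam f →
      ∀ i, IsFormEigenfunction (F' i) (E' i) (ν i) (lam' i) (f ∘ S i))
    (hglue : ∀ f : ι → ℝ → ℝ, (∀ i, IsFormEigenfunction (F' i) (E' i) (ν i) (lam' i) (f i)) →
      ∃ g, IsFormEigenfunction F E μ lam g ∧ MemLp g 2 μ ∧ ∀ i, g ∘ S i =ᵐ[ν i] f i) :
    Cardinal.toENat (Module.rank ℝ (formEigenspace F E μ lam)) =
      ∑ i, Cardinal.toENat (Module.rank ℝ (formEigenspace (F' i) (E' i) (ν i) (lam' i))) := by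
  have hle := map_le_inv_smul hp hp' hμ
  have hfin : ∀ i, (p i)⁻¹ ≠ ⊤ := fun i => ENNReal.inv_ne_top.2 (hp i)
  let T : Lp ℝ 2 μ →ₗ[ℝ] ∀ i, Lp ℝ 2 (ν i) :=
    LinearMap.pi fun i => Lp.compOfMapLeSMul (hS i).measurable (hfin i) (hle i)
  have hT : ∀ φ i, T φ i =ᵐ[ν i] φ ∘ S i := fun φ i =>
    Lp.coeFn_compOfMapLeSMul (hS i).measurable (hfin i) (hle i) φ
  have hac : ∀ {φ ψ : ℝ → ℝ}, φ =ᵐ[μ] ψ → ∀ i, φ ∘ S i =ᵐ[ν i] ψ ∘ S i := fun h i =>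
    ae_of_ae_map (hS i).measurable.aemeasurable
      ((Measure.absolutelyContinuous_of_le_smul (hle i)).ae_le h)
  rw [formEigenspace_eq_span, Finset.sum_congr rfl fun i _ => by rw [formEigenspace_eq_span]]
  refine toENat_rank_span_eq_sum T ?_ _ _ (fun i => ⟨0, h0 i, Lp.coeFn_zero _ _ _⟩) ?_
  -- Injectivity: `μ` is carried by the images of the `S i`, so a class is determined by its
  -- pullbacks.
  · intro φ ψ h
    refine Lp.ext (ae_of_forall_ae_comp hS hμ fun i => ?_)
    have h1 := hT φ i
    rw [h] at h1
    exact h1.symm.trans (hT ψ i)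
  · ext Φ
    constructor
    · rintro ⟨φ, ⟨f, hf, hφ⟩, rfl⟩ i -
      exact ⟨f ∘ S i, hres f hf i, (hT φ i).trans (hac hφ i)⟩
    · intro h
      choose f hf hΦ using fun i => h i (mem_univ i)
      obtain ⟨g, hg, hg2, hgf⟩ := hglue f hf
      refine ⟨hg2.toLp g, ⟨g, hg, hg2.coeFn_toLp⟩, ?_⟩
      funext i
      exact Lp.ext ((hT _ i).trans ((hac hg2.coeFn_toLp i).trans ((hgf i).trans (hΦ i).symm)))

end Decoupling

/-- Counting functions add up when the multiplicities do, after rescaling. -/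
theorem formCount_eq_sum_of_rank {ι : Type*} [Fintype ι] {μ : Measure ℝ} {ν : ι → Measure ℝ}
    {F : Set (ℝ → ℝ)} {E : (ℝ → ℝ) → (ℝ → ℝ) → ℝ}
    {F' : ι → Set (ℝ → ℝ)} {E' : ι → (ℝ → ℝ) → (ℝ → ℝ) → ℝ} {t : ι → ℝ} (ht : ∀ i, 0 < t i)
    (h : ∀ lam, Cardinal.toENat (Module.rank ℝ (formEigenspace F E μ lam)) =
      ∑ i, Cardinal.toENat (Module.rank ℝ (formEigenspace (F' i) (E' i) (ν i) (t i * lam))))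
    (x : ℝ) : formCount F E μ x = ∑ i, formCount (F' i) (E' i) (ν i) (t i * x) := by
  unfold formCount
  rw [tsum_congr fun lam : Iic x => h lam]
  rw [Summable.tsum_finsetSum fun i _ => ENat.summable_of_any _]
  refine Finset.sum_congr rfl fun i _ => ?_
  let e : Iic x ≃ Iic (t i * x) :=
    { toFun := fun y => ⟨t i * y, mul_le_mul_of_nonneg_left y.2 (ht i).le⟩
      invFun := fun y => ⟨(t i)⁻¹ * y, by
        have := mul_le_mul_of_nonneg_left y.2 (inv_pos.2 (ht i)).le
        rwa [inv_mul_cancel_left₀ (ht i).ne'] at this⟩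
      left_inv := fun y => Subtype.ext (inv_mul_cancel_left₀ (ht i).ne' _)
      right_inv := fun y => Subtype.ext (mul_inv_cancel_left₀ (ht i).ne' _) }
  exact e.tsum_eq fun y : Iic (t i * x) =>
    Cardinal.toENat (Module.rank ℝ (formEigenspace (F' i) (E' i) (ν i) y))

/-! ### Functions in `H¹` -/

theorem MemH1.congr {u v : ℝ} {f f' : ℝ → ℝ} (h : MemH1 u v f) (hf : EqOn f f' (Ioo u v)) :
    MemH1 u v f' := by
  obtain ⟨g, hg, hfg⟩ := h
  exact ⟨g, hg, fun s hs t ht => by rw [← hf hs, ← hf ht, hfg s hs t ht]⟩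

theorem memH1_zero (u v : ℝ) : MemH1 u v 0 :=
  ⟨0, MemLp.zero', fun s _ t _ => by simp⟩

/-- An `H¹` function on `(u, v)` extends continuously to `[u, v]`. -/
theorem MemH1.exists_continuousOn_Icc {u v : ℝ} {f : ℝ → ℝ} (hf : MemH1 u v f) :
    ∃ h : ℝ → ℝ, ContinuousOn h (Icc u v) ∧ EqOn f h (Ioo u v) := by
  rcases le_or_gt v u with huv | huv
  · exact ⟨0, continuousOn_const, by simp [Ioo_eq_empty_of_le huv]⟩
  obtain ⟨g, hg, hfg⟩ := hf
  have hint : IntegrableOn g (Icc u v) :=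
    (integrableOn_Icc_iff_integrableOn_Ioo (μ := volume)).2 (hg.integrable (by norm_num))
  obtain ⟨s, hs⟩ := nonempty_Ioo.2 huv
  -- The value `f u` carries no information, so the primitive starting at `u` is normalized at an
  -- interior point `s`.
  refine ⟨fun t => f s - (∫ y in u..s, g y) + ∫ y in u..t, g y, ?_, fun t ht => ?_⟩
  · have := intervalIntegral.continuousOn_primitive_interval (a := u) (b := v) (f := g)
      (μ := volume) (by rwa [uIcc_of_le huv.le])
    rw [uIcc_of_le huv.le] at this
    exact continuousOn_const.add this
  · have hi : ∀ t ∈ Ioo u v, IntervalIntegrable g volume u t := fun t ht =>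
      (intervalIntegrable_iff_integrableOn_Icc_of_le ht.1.le).2
        (hint.mono_set (Icc_subset_Icc_right ht.2.le))
    have := intervalIntegral.integral_interval_sub_left (hi t ht) (hi s hs)
    have h2 := hfg s hs t ht
    simp only
    linarith

/-- The continuous extension to the compact interval is bounded, and `ν` is finite and lives where
`f` agrees with it. -/
theorem MemH1.memLp {u v : ℝ} {f : ℝ → ℝ} (hf : MemH1 u v f) {ν : Measure ℝ} [IsFiniteMeasure ν]
    (hν : ∀ᵐ x ∂ν, x ∈ Ioo u v) (p : ENNReal) : MemLp f p ν := by
  obtain ⟨h, hc, hfh⟩ := hf.exists_continuousOn_Icc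
  obtain ⟨C, hC⟩ := isCompact_Icc.exists_bound_of_continuousOn hc
  have h1 : f =ᵐ[ν] h := hν.mono fun x hx => hfh hx
  refine (memLp_congr_ae h1).2 (MemLp.of_bound ?_ C (hν.mono fun x hx => hC x ⟨hx.1.le, hx.2.le⟩))
  rw [← Measure.restrict_eq_self_of_ae_mem hν]
  exact (hc.mono Ioo_subset_Icc_self).aestronglyMeasurable measurableSet_Ioo

/-- The energy on `(u, v)` only depends on the restrictions of the functions to `(u, v)`. -/
theorem energy_congr {u v : ℝ} {f f' g g' : ℝ → ℝ} (hf : EqOn f f' (Ioo u v))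
    (hg : EqOn g g' (Ioo u v)) : energy u v f g = energy u v f' g' := by
  refine setIntegral_congr_fun measurableSet_Ioo fun x hx => ?_
  have hx' := Ioo_mem_nhds hx.1 hx.2
  simp only [(hf.eventuallyEq_of_mem hx').deriv_eq, (hg.eventuallyEq_of_mem hx').deriv_eq]

theorem energy_zero_left (u v : ℝ) (g : ℝ → ℝ) : energy u v 0 g = 0 := by simp [energy]

theorem energy_zero_right (u v : ℝ) (f : ℝ → ℝ) : energy u v f 0 = 0 := by simp [energy]

/-! ### Forms decoupled along a finite family of cells and gaps -/

section Cells

variable {ι κ : Type*} [Fintype ι] {S : ι → ℝ → ℝ} {a b : ℝ}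

open Classical in
/-- The function that equals `f i ∘ (S i)⁻¹` on the open cell `S i '' (a, b)` and vanishes off the
open cells. -/
noncomputable def glueCells (S : ι → ℝ → ℝ) (a b : ℝ) (f : ι → ℝ → ℝ) (y : ℝ) : ℝ :=
  if h : ∃ i, y ∈ S i '' Ioo a b then f h.choose (h.choose_spec.choose) else 0

/-- The choices in `glueCells` are forced: the index by disjointness of the open cells, the preimage
by injectivity. -/
theorem glueCells_comp (hinj : ∀ i, Function.Injective (S i))
    (hdisj : Pairwise fun i j => Disjoint (S i '' Ioo a b) (S j '' Ioo a b)) (f : ι → ℝ → ℝ)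
    (i : ι) : EqOn (glueCells S a b f ∘ S i) (f i) (Ioo a b) := by
  intro x hx
  have h : ∃ j, S i x ∈ S j '' Ioo a b := ⟨i, x, hx, rfl⟩
  have hj : h.choose = i := by
    by_contra hne
    exact (hdisj hne).ne_of_mem h.choose_spec ⟨x, hx, rfl⟩ rfl
  have hs := h.choose_spec.choose_spec.2
  simp only [Function.comp_apply, glueCells, dif_pos h]
  generalize h.choose_spec.choose = z at hs
  generalize h.choose = j at hj hs
  subst hj
  rw [hinj _ hs]

theorem glueCells_eqOn_zero {T : Set ℝ} (hT : ∀ i, Disjoint T (S i '' Ioo a b))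
    (f : ι → ℝ → ℝ) : EqOn (glueCells S a b f) 0 T := by
  intro y hy
  have h : ¬ ∃ i, y ∈ S i '' Ioo a b := fun ⟨i, hi⟩ => (hT i).ne_of_mem hy hi rfl
  exact dif_neg h

/-- The counting function of a form that is decoupled along finitely many disjoint cells `S i (a, b)`
and gaps `(u j, v j)` is the sum of the rescaled counting functions of the cells, when the measure
is a combination of images of measures under the maps `S i`. -/
theorem formCount_decoupled_eq_sum (hS : ∀ i, MeasurableEmbedding (S i))
    (hdisj : Pairwise fun i j => Disjoint (S i '' Ioo a b) (S j '' Ioo a b))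
    {u v : κ → ℝ} (hgap : ∀ j i, Disjoint (Ioo (u j) (v j)) (S i '' Ioo a b))
    {μ : Measure ℝ} {ν : ι → Measure ℝ} [∀ i, IsFiniteMeasure (ν i)]
    (hν : ∀ i, ∀ᵐ x ∂(ν i), x ∈ Ioo a b)
    {p r : ι → ℝ} (hp : ∀ i, 0 < p i) (hr : ∀ i, 0 < r i)
    (hμ : μ = ∑ i, ENNReal.ofReal (p i) • (ν i).map (S i)) (x : ℝ) :
    formCount {f | (∀ i, MemH1 a b (f ∘ S i)) ∧ ∀ j, MemH1 (u j) (v j) f}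
      (fun f g => (∑ i, 1 / r i * energy a b (f ∘ S i) (g ∘ S i)) +
        ∑' j, energy (u j) (v j) f g) μ x =
      ∑ i, formCount {f | MemH1 a b f} (energy a b) (ν i) (r i * p i * x) := by
  classical
  have hinj : ∀ i, Function.Injective (S i) := fun i => (hS i).injective
  have hglueMem : ∀ f : ι → ℝ → ℝ, (∀ i, MemH1 a b (f i)) →
      (∀ i, MemH1 a b (glueCells S a b f ∘ S i)) ∧ ∀ j, MemH1 (u j) (v j) (glueCells S a b f) :=
    fun f hf => ⟨fun i => (hf i).congr (glueCells_comp hinj hdisj f i).symm,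
      fun j => (memH1_zero _ _).congr (glueCells_eqOn_zero (hgap j) f).symm⟩
  have hint : ∀ f : ℝ → ℝ, (∀ i, Integrable (f ∘ S i) (ν i)) →
      ∫ x, f x ∂μ = ∑ i, p i * ∫ x, f (S i x) ∂(ν i) := by
    intro f hf
    rw [hμ, integral_finsetSum_measure fun i _ =>
      ((hS i).integrable_map_iff.2 (hf i)).smul_measure ENNReal.ofReal_ne_top]
    refine Finset.sum_congr rfl fun i _ => ?_
    rw [integral_smul_measure, (hS i).integral_map, ENNReal.toReal_ofReal (hp i).le, smul_eq_mul]
  have hmul : ∀ (i : ι) (f g : ℝ → ℝ), MemH1 a b f → MemH1 a b g →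
      Integrable (fun x => f x * g x) (ν i) := fun i f g hf hg =>
    (hf.memLp (hν i) 2).integrable_mul (hg.memLp (hν i) 2)
  refine formCount_eq_sum_of_rank (t := fun i => r i * p i) (fun i => mul_pos (hr i) (hp i))
    (fun lam => ?_) x
  refine toENat_rank_formEigenspace_eq_sum hS (fun i => (ENNReal.ofReal_pos.2 (hp i)).ne')
    (fun i => ENNReal.ofReal_ne_top) hμ (fun i => ⟨memH1_zero a b, fun g _ => ?_⟩) ?_ ?_
  · simp [energy_zero_left]
  · rintro f ⟨⟨hf, hf'⟩, hE⟩ i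
    refine ⟨hf i, fun g hg => ?_⟩
    -- The test function is `g` transplanted to the cell `i` and zero elsewhere; it is admissible
    -- because the domain requires no continuity across cell boundaries.
    let G : ι → ℝ → ℝ := fun j => if j = i then g else 0
    have hG : ∀ j, MemH1 a b (G j) := fun j => by
      by_cases h : j = i
      · simpa [G, h] using hg
      · simpa [G, h] using memH1_zero a b
    have key := hE _ (hglueMem G hG)
    -- Every gap term vanishes, so the sum over the gaps is zero without any finiteness of `κ`.
    have e1 : ∀ j, energy (u j) (v j) f (glueCells S a b G) = 0 := fun j => by
      rw [energy_congr (fun _ _ => rfl) (glueCells_eqOn_zero (hgap j) G), energy_zero_right]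
    have e2 : ∀ j, energy a b (f ∘ S j) (glueCells S a b G ∘ S j) =
        if j = i then energy a b (f ∘ S i) g else 0 := fun j => by
      rw [energy_congr (fun _ _ => rfl) (glueCells_comp hinj hdisj G j)]
      by_cases h : j = i
      · subst h; simp [G]
      · simp [G, h, energy_zero_right]
    have e3 : ∀ j, ∫ x, f (S j x) * glueCells S a b G (S j x) ∂(ν j) =
        if j = i then ∫ x, f (S i x) * g x ∂(ν i) else 0 := fun j => by
      have : ∫ x, f (S j x) * glueCells S a b G (S j x) ∂(ν j) =
          ∫ x, f (S j x) * G j x ∂(ν j) :=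
        integral_congr_ae ((hν j).mono fun x hx => by
          have := glueCells_comp hinj hdisj G j hx
          simp only [Function.comp_apply] at this
          simp only [this])
      rw [this]
      by_cases h : j = i
      · subst h; simp [G]
      · simp [G, h]
    rw [hint (fun x => f x * glueCells S a b G x) fun j =>
      hmul j (f ∘ S j) (glueCells S a b G ∘ S j) (hf j) ((hglueMem G hG).1 j)] at key
    simp only [e1, e2, e3, tsum_zero, add_zero, mul_ite, mul_zero, Finset.sum_ite_eq',
      Finset.mem_univ, if_true] at key
    -- Now `key` reads `1 / r i * energy = lam * (p i * integral)`; multiplying by `r i` gives the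
    -- rescaled eigenvalue.
    have hr' := (hr i).ne'
    field_simp at key
    simp only [Function.comp_apply]
    linarith
  · intro f hf
    have hmem := hglueMem f fun i => (hf i).1
    have hcomp := glueCells_comp hinj hdisj f
    have hae : ∀ i, glueCells S a b f ∘ S i =ᵐ[ν i] f i := fun i =>
      (hν i).mono fun x hx => hcomp i hx
    refine ⟨glueCells S a b f, ⟨hmem, fun g hg => ?_⟩, ?_, hae⟩
    · have e1 : ∀ j, energy (u j) (v j) (glueCells S a b f) g = 0 := fun j => by
        rw [energy_congr (glueCells_eqOn_zero (hgap j) f) (fun _ _ => rfl), energy_zero_left]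
      rw [hint (fun x => glueCells S a b f x * g x) fun j =>
        hmul j (glueCells S a b f ∘ S j) (g ∘ S j) (hmem.1 j) (hg.1 j)]
      simp only [e1, tsum_zero, add_zero, Finset.mul_sum]
      refine Finset.sum_congr rfl fun i _ => ?_
      rw [energy_congr (hcomp i) (fun _ _ => rfl), (hf i).2 _ (hg.1 i)]
      have : ∫ x, glueCells S a b f (S i x) * g (S i x) ∂(ν i) = ∫ x, f i x * (g ∘ S i) x ∂(ν i) :=
        integral_congr_ae ((hae i).mono fun x hx => by
          simp only [Function.comp_apply] at hx ⊢
          rw [hx])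
      rw [this]
      have hr' := (hr i).ne'
      field_simp
    · rw [hμ]
      have : ∀ i, MemLp (glueCells S a b f) 2 (ENNReal.ofReal (p i) • (ν i).map (S i)) := fun i =>
        ((hS i).memLp_map_measure_iff.2 ((hmem.1 i).memLp (hν i) 2)).smul_measure
          ENNReal.ofReal_ne_top
      have hm : AEStronglyMeasurable (glueCells S a b f)
          (∑ i, ENNReal.ofReal (p i) • (ν i).map (S i)) := by
        rw [← Measure.sum_fintype, aestronglyMeasurable_sum_measure_iff]
        exact fun i => (this i).1
      rw [memLp_two_iff_integrable_sq hm, integrable_finsetSum_measure]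
      exact fun i _ => (this i).integrable_sq

end Cells

/-! ### Weighted systems and individuals of a tree -/

namespace WeightedIFS

variable {a b : ℝ} (s : WeightedIFS a b)

theorem map_strictMono (i : Fin s.N) : StrictMono (s.map i) := fun x y h => by
  have := mul_lt_mul_of_pos_left h (s.r_pos i)
  simp only [map]; linarith

theorem continuous_map (i : Fin s.N) : Continuous (s.map i) := by
  unfold map; fun_prop

/-- The index of the first map. -/
def first : Fin s.N := ⟨0, by have := s.two_le; omega⟩

theorem map_first : s.map s.first a = a := s.left_end

theorem lt_map_left (hab : a < b) (i : Fin s.N) (hi : i ≠ s.first) : a < s.map i a := by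
  have h0 : s.first < i := by
    rw [Ne, Fin.ext_iff] at hi
    rw [Fin.lt_def]
    simp only [first] at hi ⊢
    omega
  have h1 := s.ordered _ _ h0
  have h2 := s.map_strictMono s.first hab
  rw [map_first] at h2
  exact h2.trans_le h1

theorem left_le_map (hab : a < b) (i : Fin s.N) : a ≤ s.map i a := by
  by_cases hi : i = s.first
  · rw [hi, map_first]
  · exact (s.lt_map_left hab i hi).le

/-- The index of the last map. -/
def last : Fin s.N := ⟨s.N - 1, by have := s.two_le; omega⟩

theorem map_last : s.map s.last b = b := s.right_end

theorem map_right_lt (hab : a < b) (i : Fin s.N) (hi : i ≠ s.last) : s.map i b < b := by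
  have h0 : i < s.last := by
    have := i.2
    rw [Ne, Fin.ext_iff] at hi
    rw [Fin.lt_def]
    simp only [last] at hi ⊢
    omega
  have h1 := s.ordered _ _ h0
  have h2 := s.map_strictMono s.last hab
  rw [map_last] at h2
  exact lt_of_le_of_lt h1 h2

theorem map_le_right (hab : a < b) (i : Fin s.N) : s.map i b ≤ b := by
  by_cases hi : i = s.last
  · rw [hi, map_last]
  · exact (s.map_right_lt hab i hi).le

theorem m_le_one (i : Fin s.N) : s.m i ≤ 1 := by
  rw [← s.m_sum]
  exact Finset.single_le_sum (fun j _ => (s.m_pos j).le) (Finset.mem_univ i)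

end WeightedIFS

namespace VTree

variable {J : Type*} {a b : ℝ} {ifs : J → WeightedIFS a b} {V : ℕ}

namespace Node

theorem scale_pos {I : VTree ifs V} (w : Node I) : 0 < w.scale := by
  induction w with
  | root I => exact one_pos
  | cons i w ih => exact mul_pos (WeightedIFS.r_pos _ _) ih

theorem weight_pos {I : VTree ifs V} (w : Node I) : 0 < w.weight := by
  induction w with
  | root I => exact one_pos
  | cons i w ih => exact mul_pos (WeightedIFS.m_pos _ _) ih

theorem scale_le_pow {hi : ℝ} (hr : ∀ j i, (ifs j).r i ≤ hi) {I : VTree ifs V} (w : Node I) :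
    w.scale ≤ hi ^ w.length := by
  induction w with
  | root I => simp [scale, length]
  | @cons I i w ih =>
    rw [scale, length, pow_succ']
    exact mul_le_mul (hr _ _) ih w.scale_pos.le ((WeightedIFS.r_pos _ _).le.trans (hr _ i))

theorem scale_le_one {I : VTree ifs V} (w : Node I) : w.scale ≤ 1 := by
  simpa using scale_le_pow (fun j i => ((ifs j).r_lt_one i).le) w

theorem weight_le_pow {hi : ℝ} (hm : ∀ j i, (ifs j).m i ≤ hi) {I : VTree ifs V} (w : Node I) :
    w.weight ≤ hi ^ w.length := by
  induction w with
  | root I => simp [weight, length]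
  | @cons I i w ih =>
    rw [weight, length, pow_succ']
    exact mul_le_mul (hm _ _) ih w.weight_pos.le ((WeightedIFS.m_pos _ _).le.trans (hm _ i))

theorem map_apply {I : VTree ifs V} (w : Node I) (x y : ℝ) :
    w.map x - w.map y = w.scale * (x - y) := by
  induction w with
  | root I => simp [map, scale]
  | cons i w ih =>
    simp only [map, scale, Function.comp_apply, WeightedIFS.map, mul_assoc, ← ih]
    ring

theorem map_strictMono {I : VTree ifs V} (w : Node I) : StrictMono w.map := fun x y h => by
  rw [← sub_pos, map_apply]
  exact mul_pos w.scale_pos (sub_pos.2 h)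

theorem continuous_map {I : VTree ifs V} (w : Node I) : Continuous w.map := by
  induction w with
  | root I => exact continuous_id
  | cons i w ih => exact (WeightedIFS.continuous_map _ _).comp ih

theorem measurableEmbedding_map {I : VTree ifs V} (w : Node I) : MeasurableEmbedding w.map :=
  w.continuous_map.measurableEmbedding w.map_strictMono.injective

theorem left_le_map (hab : a < b) {I : VTree ifs V} (w : Node I) : a ≤ w.map a := by
  induction w with
  | root I => exact le_rfl
  | cons i w ih =>
    exact (WeightedIFS.left_le_map _ hab i).trans ((WeightedIFS.map_strictMono _ i).monotone ih)

theorem map_le_right (hab : a < b) {I : VTree ifs V} (w : Node I) : w.map b ≤ b := by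
  induction w with
  | root I => exact le_rfl
  | cons i w ih =>
    exact ((WeightedIFS.map_strictMono _ i).monotone ih).trans (WeightedIFS.map_le_right _ hab i)

theorem map_mem_Icc (hab : a < b) {I : VTree ifs V} (w : Node I) {x : ℝ} (hx : x ∈ Icc a b) :
    w.map x ∈ Icc a b :=
  ⟨(w.left_le_map hab).trans (w.map_strictMono.monotone hx.1),
    (w.map_strictMono.monotone hx.2).trans (w.map_le_right hab)⟩

/-! ### Ancestors -/

theorem take_zero {I : VTree ifs V} (w : Node I) : w.take 0 = root I := by
  cases w <;> rfl

theorem take_of_length_le {I : VTree ifs V} (w : Node I) {n : ℕ} (h : w.length ≤ n) :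
    w.take n = w := by
  induction w generalizing n with
  | root I => cases n <;> rfl
  | cons i w ih =>
    cases n with
    | zero => exact absurd h (Nat.not_succ_le_zero _)
    | succ n => rw [take, ih (Nat.succ_le_succ_iff.1 h)]

theorem take_length {I : VTree ifs V} (w : Node I) : w.take w.length = w :=
  w.take_of_length_le le_rfl

theorem length_take {I : VTree ifs V} (w : Node I) (n : ℕ) :
    (w.take n).length = min n w.length := by
  induction w generalizing n with
  | root I => cases n <;> simp [take, length]
  | cons i w ih => cases n <;> simp [take, length, ih]

theorem take_take {I : VTree ifs V} (w : Node I) {m n : ℕ} (h : n ≤ m) :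
    (w.take m).take n = w.take n := by
  induction w generalizing m n with
  | root I => cases m <;> cases n <;> rfl
  | cons i w ih =>
    cases n with
    | zero => rw [take_zero, take_zero]
    | succ n =>
      cases m with
      | zero => omega
      | succ m => rw [take, take, take, ih (by omega)]

/-- Each further generation multiplies the product by some `m i * r i ≤ 1`, so it cannot increase
along a line of descent. -/
theorem weight_mul_scale_le_take {I : VTree ifs V} (w : Node I) (n : ℕ) :
    w.weight * w.scale ≤ (w.take n).weight * (w.take n).scale := by
  induction w generalizing n with
  | root I => cases n <;> exact le_rfl
  | @cons I i w ih =>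
    have h1 : 0 < I.sys.m i * I.sys.r i := mul_pos (I.sys.m_pos i) (I.sys.r_pos i)
    have h2 : I.sys.m i * I.sys.r i ≤ 1 :=
      mul_le_one₀ (I.sys.m_le_one i) (I.sys.r_pos i).le (I.sys.r_lt_one i).le
    cases n with
    | zero =>
      have h3 := ih 0
      rw [take_zero] at h3 ⊢
      simp only [weight, scale, mul_one] at h3 ⊢
      calc I.sys.m i * w.weight * (I.sys.r i * w.scale)
          = I.sys.m i * I.sys.r i * (w.weight * w.scale) := by ring
        _ ≤ 1 := mul_le_one₀ h2 (mul_pos w.weight_pos w.scale_pos).le h3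
    | succ n =>
      simp only [take, weight, scale]
      calc I.sys.m i * w.weight * (I.sys.r i * w.scale)
          = I.sys.m i * I.sys.r i * (w.weight * w.scale) := by ring
        _ ≤ I.sys.m i * I.sys.r i * ((w.take n).weight * (w.take n).scale) :=
          mul_le_mul_of_nonneg_left (ih n) h1.le
        _ = _ := by ring

theorem take_weight_mul_scale_antitone {I : VTree ifs V} (w : Node I) {m n : ℕ} (h : n ≤ m) :
    (w.take m).weight * (w.take m).scale ≤ (w.take n).weight * (w.take n).scale := by
  rw [← take_take w h]
  exact weight_mul_scale_le_take _ _

end Node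

/-! ### Cuts of a tree -/

/-- A cut of a tree: either the ancestor alone, or a union of cuts of the subtrees rooted at its
children. -/
inductive IsCut : {I : VTree ifs V} → Set (Node I) → Prop
  | root (I : VTree ifs V) : IsCut {Node.root I}
  | branch {I : VTree ifs V} (Λ : ∀ i, Set (Node (I.child i))) (h : ∀ i, IsCut (Λ i)) :
      IsCut (⋃ i, Node.cons i '' Λ i)

theorem IsCut.finite {I : VTree ifs V} {Λ : Set (Node I)} (h : IsCut Λ) : Λ.Finite := by
  induction h with
  | root I => exact finite_singleton _
  | branch Λ h ih => exact finite_iUnion fun i => (ih i).image _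

/-- Cells below different children are separated by the order of the first-generation cells; below a
common child, the increasing map `S_i` preserves the order obtained by induction. -/
theorem IsCut.ordered (hab : a < b) {I : VTree ifs V} {Λ : Set (Node I)} (h : IsCut Λ) :
    ∀ w ∈ Λ, ∀ w' ∈ Λ, w ≠ w' → w.map b ≤ w'.map a ∨ w'.map b ≤ w.map a := by
  induction h with
  | root I =>
    rintro w rfl w' rfl h
    exact absurd rfl h
  | @branch I Λ h ih =>
    have key : ∀ i j (w : Node (I.child i)) (w' : Node (I.child j)), i < j →
        (Node.cons i w).map b ≤ (Node.cons j w').map a := fun i j w w' hij =>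
      ((I.sys.map_strictMono i).monotone (w.map_le_right hab)).trans
        ((I.sys.ordered i j hij).trans
          ((I.sys.map_strictMono j).monotone (w'.left_le_map hab)))
    intro w hw w' hw' hne
    obtain ⟨i, w, hwi, rfl⟩ := mem_iUnion.1 hw
    obtain ⟨j, w', hwj, rfl⟩ := mem_iUnion.1 hw'
    rcases lt_trichotomy i j with hij | rfl | hij
    · exact Or.inl (key i j w w' hij)
    · exact (ih i w hwi w' hwj fun h => hne (by rw [h])).imp
        (fun h => (I.sys.map_strictMono i).monotone h)
        (fun h => (I.sys.map_strictMono i).monotone h)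
    · exact Or.inr (key j i w' w hij)

/-- An antichain that meets every line of descent by generation `n` is a cut. -/
theorem isCut_of_antichain (n : ℕ) {I : VTree ifs V} (Λ : Set (Node I))
    (hanti : ∀ w ∈ Λ, ∀ j, w.take j ∈ Λ → w.take j = w)
    (hcover : ∀ w : Node I, w.length = n → ∃ j, w.take j ∈ Λ) : IsCut Λ := by
  -- The root is an ancestor of every node, so an antichain containing it has no other element.
  have hroot : ∀ {I : VTree ifs V} {Λ : Set (Node I)},
      (∀ w ∈ Λ, ∀ j, w.take j ∈ Λ → w.take j = w) → Node.root I ∈ Λ → IsCut Λ := by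
    intro I Λ hanti h
    have : Λ = {Node.root I} := by
      refine Subset.antisymm (fun w hw => ?_) (singleton_subset_iff.2 h)
      have := hanti w hw 0 (by rwa [Node.take_zero])
      rw [Node.take_zero] at this
      exact this.symm
    rw [this]
    exact IsCut.root I
  induction n generalizing I with
  | zero =>
    obtain ⟨j, hj⟩ := hcover (Node.root I) rfl
    refine hroot hanti ?_
    cases j <;> exact hj
  | succ n ih =>
    by_cases h : Node.root I ∈ Λ
    · exact hroot hanti h
    have hΛ : Λ = ⋃ i, Node.cons i '' {w | Node.cons i w ∈ Λ} := by
      ext w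
      simp only [mem_iUnion]
      constructor
      · intro hw
        cases w with
        | root => exact absurd hw h
        | cons i w => exact ⟨i, w, hw, rfl⟩
      · rintro ⟨i, w, hw, rfl⟩
        exact hw
    rw [hΛ]
    refine IsCut.branch _ fun i => ih _ (fun w hw j hj => ?_) fun w hw => ?_
    · have := hanti (Node.cons i w) hw (j + 1) hj
      rw [Node.take] at this
      simpa using this
    · obtain ⟨j, hj⟩ := hcover (Node.cons i w) (by rw [Node.length, hw])
      cases j with
      | zero => exact absurd hj h
      | succ j => exact ⟨j, hj⟩

/-- Infinitely many necks are essential: past the end of a finite set `Nat.nth` takes the default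
value `0`. -/
theorem neckLevel_strictMono {I : VTree ifs V} (hneck : {n : ℕ | (I.env n).IsNeck}.Infinite) :
    StrictMono I.neckLevel := by
  refine strictMono_nat_of_lt_succ fun l => ?_
  cases l with
  | zero => exact Nat.succ_pos _
  | succ l => exact Nat.succ_lt_succ (Nat.nth_strictMono hneck (Nat.lt_succ_self l))

/-- For `k ≥ 1`, the products `m r` read at the neck levels start at `1 > e⁻ᵏ`, do not increase
along a line of descent, and tend to `0`. The line is cut exactly at the first neck level where the
product is at most `e⁻ᵏ`. -/
theorem isCut_cutSet {hi : ℝ} (hhi : hi < 1) (hm : ∀ j i, (ifs j).m i ≤ hi) {I : VTree ifs V}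
    (hneck : {n : ℕ | (I.env n).IsNeck}.Infinite) (k : ℕ) : IsCut (I.cutSet k) := by
  rcases eq_or_ne k 0 with rfl | hk
  · simpa [cutSet] using IsCut.root I
  have hmono := neckLevel_strictMono hneck
  have hhi0 : 0 < hi := (I.sys.m_pos I.sys.first).trans_le (hm _ _)
  obtain ⟨L, hL⟩ := exists_pow_lt_of_lt_one (Real.exp_pos (-(k : ℝ))) hhi
  simp only [cutSet, hk, if_false]
  refine isCut_of_antichain (I.neckLevel (L + 1)) _ ?_ ?_
  · rintro w ⟨l, hl, -, hlt⟩ j ⟨l', hl', hle', -⟩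
    by_contra hne
    rw [Node.length_take] at hl'
    have hj : j < w.length := not_le.1 fun hj => hne (w.take_of_length_le hj)
    rw [min_eq_left hj.le] at hl'
    rw [hl', hl, hmono.lt_iff_lt] at hj
    -- As `l' < l`, the level `n(l' + 1)` is at most `n(l)`, so the product is already at most `e⁻ᵏ`
    -- at `n(l)`, against `hlt`.
    have := Node.take_weight_mul_scale_antitone w (hmono.monotone (show l' + 1 ≤ l by omega))
    rw [← hl'] at this
    linarith
  · intro w hw
    have hexL : (w.take (I.neckLevel (L + 1))).weight * (w.take (I.neckLevel (L + 1))).scale ≤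
        Real.exp (-k) := by
      rw [← hw, Node.take_length]
      calc w.weight * w.scale ≤ w.weight :=
            mul_le_of_le_one_right w.weight_pos.le w.scale_le_one
        _ ≤ hi ^ w.length := Node.weight_le_pow hm w
        _ ≤ hi ^ L := pow_le_pow_of_le_one hhi0.le hhi.le
            (hw ▸ (Nat.le_succ L).trans (hmono.id_le (L + 1)))
        _ ≤ _ := hL.le
    classical
    have hex : ∃ l, (w.take (I.neckLevel (l + 1))).weight * (w.take (I.neckLevel (l + 1))).scale ≤
        Real.exp (-k) := ⟨L, hexL⟩
    have hle : Nat.find hex ≤ L := Nat.find_min' hex hexL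
    refine ⟨I.neckLevel (Nat.find hex + 1), Nat.find hex, ?_, Nat.find_spec hex, ?_⟩
    · rw [Node.length_take, hw, min_eq_left (hmono.monotone (by omega))]
    · rw [Node.take_take w (hmono.monotone (Nat.le_succ _))]
      -- The strict inequality one neck earlier is minimality of `Nat.find`, or, if that neck is
      -- level `0`, the bound `e⁻ᵏ < 1`.
      rcases Nat.eq_zero_or_eq_succ_pred (Nat.find hex) with h | h
      · rw [h, neckLevel, Node.take_zero]
        simpa [Node.weight, Node.scale] using Nat.pos_of_ne_zero hk
      · have := Nat.find_min hex (m := (Nat.find hex).pred) (by omega)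
        rw [not_le, ← Nat.succ_eq_add_one, ← h] at this
        exact this

end VTree

/-! ### The Cantor measure of a tree -/

theorem baseMeasure_univ {a b : ℝ} (hab : a < b) : (baseMeasure a b : Measure ℝ) univ = 1 := by
  have h : 0 < ENNReal.ofReal (b - a) := ENNReal.ofReal_pos.2 (sub_pos.2 hab)
  have h1 : (baseMeasure a b : Measure ℝ) = (ENNReal.ofReal (b - a))⁻¹ •
      volume.restrict (Icc a b) := by
    rw [ENNReal.ofReal, ← ENNReal.coe_inv (by simpa using hab)]
    rfl
  rw [h1, Measure.smul_apply, Measure.restrict_apply_univ, Real.volume_Icc, smul_eq_mul]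
  exact ENNReal.inv_mul_cancel h.ne' ENNReal.ofReal_ne_top

theorem ae_mem_Icc_baseMeasure (a b : ℝ) : ∀ᵐ x ∂(baseMeasure a b : Measure ℝ), x ∈ Icc a b :=
  Measure.ae_smul_measure (ae_restrict_mem measurableSet_Icc) _

namespace VTree

variable {J : Type*} {a b : ℝ} {ifs : J → WeightedIFS a b} {V : ℕ}

theorem approxMeasure_zero (I : VTree ifs V) : I.approxMeasure 0 = baseMeasure a b := by
  simp only [approxMeasure, Node.level, Finset.sum_singleton, Node.weight, Real.toNNReal_one,
    one_smul, Node.map]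
  exact FiniteMeasure.toMeasure_injective Measure.map_id

/-- Nodes are grouped by their first letter. This recursion at the root, unlike one at the leaves,
passes to the limit as self-similarity of the measure. -/
theorem approxMeasure_succ (I : VTree ifs V) (n : ℕ) :
    I.approxMeasure (n + 1) =
      ∑ i, Real.toNNReal (I.sys.m i) • ((I.child i).approxMeasure n).map (I.sys.map i) := by
  simp only [approxMeasure, Node.level, Finset.sum_map, Finset.sum_sigma]
  refine Finset.sum_congr rfl fun i _ => ?_
  have h : ∀ ν : FiniteMeasure ℝ, ν.map (I.sys.map i) =
    FiniteMeasure.mapHom (I.sys.continuous_map i).measurable ν := fun _ => rfl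
  rw [h, map_sum, Finset.smul_sum]
  refine Finset.sum_congr rfl fun w _ => ?_
  rw [map_smul, smul_smul, ← Real.toNNReal_mul (I.sys.m_pos i).le, ← h]
  refine congrArg (Real.toNNReal (I.sys.m i * w.weight) • ·) ?_
  exact FiniteMeasure.toMeasure_injective
    (Measure.map_map (I.sys.continuous_map i).measurable w.continuous_map.measurable).symm

theorem toMeasure_sum_smul_map (I : VTree ifs V) (ν : ∀ _ : Fin I.sys.N, FiniteMeasure ℝ) :
    ((∑ i, Real.toNNReal (I.sys.m i) • (ν i).map (I.sys.map i) : FiniteMeasure ℝ) : Measure ℝ) =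
      ∑ i, ENNReal.ofReal (I.sys.m i) • (ν i : Measure ℝ).map (I.sys.map i) := by
  rw [FiniteMeasure.toMeasure_sum]
  rfl

theorem sum_ofReal_m (I : VTree ifs V) : ∑ i, ENNReal.ofReal (I.sys.m i) = 1 := by
  rw [← ENNReal.ofReal_sum_of_nonneg fun i _ => (I.sys.m_pos i).le, I.sys.m_sum,
    ENNReal.ofReal_one]

theorem approxMeasure_univ (hab : a < b) (n : ℕ) (I : VTree ifs V) :
    (I.approxMeasure n : Measure ℝ) univ = 1 := by
  induction n generalizing I with
  | zero => rw [approxMeasure_zero, baseMeasure_univ hab]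
  | succ n ih =>
    rw [approxMeasure_succ, toMeasure_sum_smul_map, Measure.finsetSum_apply]
    simp only [Measure.smul_apply, smul_eq_mul]
    rw [← I.sum_ofReal_m]
    refine Finset.sum_congr rfl fun i _ => ?_
    rw [Measure.map_apply (I.sys.continuous_map i).measurable MeasurableSet.univ, preimage_univ,
      ih, mul_one]

theorem sys_map_mem_Icc (hab : a < b) (I : VTree ifs V) (i : Fin I.sys.N) {x : ℝ}
    (hx : x ∈ Icc a b) : I.sys.map i x ∈ Icc a b :=
  (Node.cons i (Node.root _)).map_mem_Icc hab hx

theorem ae_mem_Icc_approxMeasure (hab : a < b) (n : ℕ) (I : VTree ifs V) :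
    ∀ᵐ x ∂(I.approxMeasure n : Measure ℝ), x ∈ Icc a b := by
  induction n generalizing I with
  | zero => rw [approxMeasure_zero]; exact ae_mem_Icc_baseMeasure a b
  | succ n ih =>
    rw [approxMeasure_succ, toMeasure_sum_smul_map, ae_finsetSum_measure_iff]
    intro i _
    refine Measure.ae_smul_measure ?_ _
    refine (ae_map_iff (p := fun x => x ∈ Icc a b)
      (I.sys.continuous_map i).measurable.aemeasurable measurableSet_Icc).2 ?_
    exact (ih (I.child i)).mono fun x hx => I.sys_map_mem_Icc hab i hx

/-! ### Existence of the weak limit and self-similarity -/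

open BoundedContinuousFunction in
theorem integral_approxMeasure_succ (I : VTree ifs V) (n : ℕ) (f : ℝ →ᵇ ℝ) :
    ∫ x, f x ∂(I.approxMeasure (n + 1) : Measure ℝ) =
      ∑ i, I.sys.m i * ∫ x, f (I.sys.map i x) ∂((I.child i).approxMeasure n : Measure ℝ) := by
  rw [approxMeasure_succ, toMeasure_sum_smul_map, integral_finsetSum_measure]
  · refine Finset.sum_congr rfl fun i _ => ?_
    rw [integral_smul_measure, integral_map (I.sys.continuous_map i).measurable.aemeasurable
      f.continuous.aestronglyMeasurable, ENNReal.toReal_ofReal (I.sys.m_pos i).le, smul_eq_mul]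
  · exact fun i _ => (f.integrable _).smul_measure ENNReal.ofReal_ne_top

open BoundedContinuousFunction in
-- Later approximations only redistribute mass inside the cells of generation `n`. Peeling off the
-- first map costs nothing because the weights sum to one; once a single cell remains, both
-- integrals are within `ε` of `f a`, whence the factor `2`.
theorem abs_integral_approxMeasure_sub_le (hab : a < b) {ε : ℝ} (n : ℕ) (I : VTree ifs V)
    (f : ℝ →ᵇ ℝ)
    (hf : ∀ w : Node I, w.length = n → ∀ x ∈ Icc a b, |f (w.map x) - f (w.map a)| ≤ ε) (m : ℕ) :
    |∫ x, f x ∂(I.approxMeasure (m + n) : Measure ℝ) -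
      ∫ x, f x ∂(I.approxMeasure n : Measure ℝ)| ≤ 2 * ε := by
  induction n generalizing I f with
  | zero =>
    have h : ∀ k, |∫ x, f x ∂(I.approxMeasure k : Measure ℝ) - f a| ≤ ε := by
      intro k
      have : IsProbabilityMeasure (I.approxMeasure k : Measure ℝ) := ⟨approxMeasure_univ hab k I⟩
      have h1 : ∫ x, f x ∂(I.approxMeasure k : Measure ℝ) - f a =
          ∫ x, (f x - f a) ∂(I.approxMeasure k : Measure ℝ) := by
        rw [integral_sub (f.integrable _) (integrable_const _)]
        simp
      rw [h1]
      have := norm_integral_le_of_norm_le_const (f := fun x => f x - f a) (C := ε) ((ae_mem_Icc_approxMeasure hab k I).mono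
        fun x hx => hf (Node.root I) rfl x hx)
      simpa using this
    have h1 := abs_le.1 (h (m + 0))
    have h2 := abs_le.1 (h 0)
    exact abs_le.2 ⟨by linarith, by linarith⟩
  | succ n ih =>
    rw [← add_assoc, integral_approxMeasure_succ, integral_approxMeasure_succ,
      ← Finset.sum_sub_distrib]
    have key : ∀ i, |∫ x, f (I.sys.map i x) ∂((I.child i).approxMeasure (m + n) : Measure ℝ) -
        ∫ x, f (I.sys.map i x) ∂((I.child i).approxMeasure n : Measure ℝ)| ≤ 2 * ε := fun i =>
      ih (I.child i) (f.compContinuous ⟨I.sys.map i, I.sys.continuous_map i⟩)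
        fun w hw x hx => hf (Node.cons i w) (by rw [Node.length, hw]) x hx
    calc _ ≤ ∑ i, I.sys.m i * (2 * ε) := by
          refine (Finset.abs_sum_le_sum_abs _ _).trans (Finset.sum_le_sum fun i _ => ?_)
          rw [← mul_sub, abs_mul, abs_of_pos (I.sys.m_pos i)]
          exact mul_le_mul_of_nonneg_left (key i) (I.sys.m_pos i).le
      _ = 2 * ε := by rw [← Finset.sum_mul, I.sys.m_sum, one_mul]

open BoundedContinuousFunction in
theorem exists_tendsto_integral_approxMeasure (hab : a < b) {hi : ℝ} (hhi : hi < 1)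
    (hr : ∀ j i, (ifs j).r i ≤ hi) (I : VTree ifs V) (f : ℝ →ᵇ ℝ) :
    ∃ l, Tendsto (fun n => ∫ x, f x ∂(I.approxMeasure n : Measure ℝ)) atTop (𝓝 l) := by
  refine cauchySeq_tendsto_of_complete (Metric.cauchySeq_iff'.2 fun ε hε => ?_)
  have huc := isCompact_Icc.uniformContinuousOn_of_continuous
    (f.continuous.continuousOn (s := Icc a b))
  -- With `ε / 3` the bound `2 * (ε / 3)` stays below `ε`; `n` is then taken so large that all cells
  -- of generation `n` are shorter than `δ`.
  obtain ⟨δ, hδ, hfδ⟩ := Metric.uniformContinuousOn_iff.1 huc (ε / 3) (by positivity)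
  have hba : 0 < b - a := sub_pos.2 hab
  obtain ⟨n, hn⟩ := exists_pow_lt_of_lt_one (div_pos hδ hba) hhi
  refine ⟨n, fun k hk => ?_⟩
  have := abs_integral_approxMeasure_sub_le hab (ε := ε / 3) n I f (fun w hw x hx => ?_) (k - n)
  · rw [Nat.sub_add_cancel hk] at this
    rw [Real.dist_eq]
    linarith
  · have ha : a ∈ Icc a b := left_mem_Icc.2 hab.le
    refine (hfδ _ (w.map_mem_Icc hab hx) _ (w.map_mem_Icc hab ha) ?_).le
    rw [Real.dist_eq, Node.map_apply, abs_of_nonneg (mul_nonneg w.scale_pos.le (sub_nonneg.2 hx.1))]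
    calc w.scale * (x - a) ≤ hi ^ n * (b - a) := by
          rw [← hw]
          exact mul_le_mul (Node.scale_le_pow hr w) (by linarith [hx.2]) (sub_nonneg.2 hx.1)
            (w.scale_pos.le.trans (Node.scale_le_pow hr w))
      _ < δ := (lt_div_iff₀ hba).1 hn

/-- The finite measures of mass at most one that live on `[a, b]`. -/
def boundedMeasuresOn (a b : ℝ) : Set (FiniteMeasure ℝ) := {μ | μ.mass ≤ 1 ∧ μ (Icc a b)ᶜ = 0}

theorem isCompact_boundedMeasuresOn (a b : ℝ) : IsCompact (boundedMeasuresOn a b) :=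
  isCompact_setOfPred_finiteMeasure_le_of_isCompact 1 isCompact_Icc

theorem approxMeasure_mem (hab : a < b) (I : VTree ifs V) (n : ℕ) :
    I.approxMeasure n ∈ boundedMeasuresOn a b := by
  constructor
  · rw [← ENNReal.coe_le_coe, FiniteMeasure.ennreal_mass, approxMeasure_univ hab]
    rfl
  · rw [FiniteMeasure.null_iff_toMeasure_null]
    exact ae_mem_Icc_approxMeasure hab n I

/-- `limUnder` means something only once a limit exists. Compactness supplies a cluster point `μ`;
since the integrals of each test function converge, their limits must be the integrals against `μ`,
so the whole sequence converges. -/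
theorem tendsto_approxMeasure (hab : a < b) {hi : ℝ} (hhi : hi < 1)
    (hr : ∀ j i, (ifs j).r i ≤ hi) (I : VTree ifs V) :
    Tendsto I.approxMeasure atTop (𝓝 (limUnder atTop I.approxMeasure)) := by
  refine tendsto_nhds_limUnder ?_
  obtain ⟨μ, -, hμ⟩ := (isCompact_boundedMeasuresOn a b).exists_mapClusterPt
    (f := atTop) (u := I.approxMeasure)
    (tendsto_principal.2 (Eventually.of_forall (I.approxMeasure_mem hab)))
  refine ⟨μ, FiniteMeasure.tendsto_iff_forall_integral_tendsto.2 fun f => ?_⟩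
  obtain ⟨l, hl⟩ := I.exists_tendsto_integral_approxMeasure hab hhi hr f
  have h1 : MapClusterPt (∫ x, f x ∂(μ : Measure ℝ)) atTop
      fun n => ∫ x, f x ∂(I.approxMeasure n : Measure ℝ) :=
    hμ.tendsto_comp (FiniteMeasure.continuous_integral_boundedContinuousFunction f).continuousAt
  have h2 : ClusterPt (∫ x, f x ∂(μ : Measure ℝ)) (𝓝 l) := ClusterPt.mono h1 hl
  rwa [eq_of_nhds_neBot h2]

instance (I : VTree ifs V) : IsFiniteMeasure I.cantorMeasure := by
  unfold cantorMeasure; infer_instance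

theorem cantorMeasure_eq_sum (hab : a < b) {hi : ℝ} (hhi : hi < 1)
    (hr : ∀ j i, (ifs j).r i ≤ hi) (I : VTree ifs V) :
    I.cantorMeasure =
      ∑ i, ENNReal.ofReal (I.sys.m i) • (I.child i).cantorMeasure.map (I.sys.map i) := by
  have h1 := (I.tendsto_approxMeasure hab hhi hr).comp (tendsto_add_atTop_nat 1)
  have h2 : Tendsto (fun n => I.approxMeasure (n + 1)) atTop
      (𝓝 (∑ i, Real.toNNReal (I.sys.m i) •
        (limUnder atTop (I.child i).approxMeasure).map (I.sys.map i))) := by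
    simp only [approxMeasure_succ]
    refine tendsto_finsetSum _ fun i _ => Tendsto.const_smul ?_ _
    exact ((FiniteMeasure.continuous_map (I.sys.continuous_map i)).tendsto _).comp
      ((I.child i).tendsto_approxMeasure hab hhi hr)
  have h3 := tendsto_nhds_unique h1 h2
  unfold cantorMeasure
  rw [h3, toMeasure_sum_smul_map]

/-! ### Support of the measure and end points -/

theorem limUnder_approxMeasure_mem (hab : a < b) {hi : ℝ} (hhi : hi < 1)
    (hr : ∀ j i, (ifs j).r i ≤ hi) (I : VTree ifs V) :
    limUnder atTop I.approxMeasure ∈ boundedMeasuresOn a b :=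
  (isCompact_boundedMeasuresOn a b).isClosed.mem_of_tendsto (I.tendsto_approxMeasure hab hhi hr)
    (Eventually.of_forall (I.approxMeasure_mem hab))

theorem cantorMeasure_univ_le (hab : a < b) {hi : ℝ} (hhi : hi < 1)
    (hr : ∀ j i, (ifs j).r i ≤ hi) (I : VTree ifs V) : I.cantorMeasure univ ≤ 1 := by
  have := (I.limUnder_approxMeasure_mem hab hhi hr).1
  rwa [← ENNReal.coe_le_coe, FiniteMeasure.ennreal_mass] at this

theorem cantorMeasure_compl_Icc (hab : a < b) {hi : ℝ} (hhi : hi < 1)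
    (hr : ∀ j i, (ifs j).r i ≤ hi) (I : VTree ifs V) : I.cantorMeasure (Icc a b)ᶜ = 0 :=
  (FiniteMeasure.null_iff_toMeasure_null _ _).1 (I.limUnder_approxMeasure_mem hab hhi hr).2

/-- A point that is fixed by one map of each system and not attained on `[a, b]` by the others has
no mass. -/
theorem cantorMeasure_singleton_eq_zero (hab : a < b) {hi hi' : ℝ} (hhi : hi < 1)
    (hr : ∀ j i, (ifs j).r i ≤ hi) (hhi' : hi' < 1) (hm : ∀ j i, (ifs j).m i ≤ hi') {c : ℝ}
    (e : ∀ I : VTree ifs V, Fin I.sys.N) (he : ∀ I : VTree ifs V, I.sys.map (e I) c = c)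
    (hne : ∀ (I : VTree ifs V) i, i ≠ e I → ∀ x ∈ Icc a b, I.sys.map i x ≠ c)
    (I : VTree ifs V) : I.cantorMeasure {c} = 0 := by
  -- Only the map fixing `c` contributes, and it reduces the mass of `{c}` to that in a child times
  -- a weight at most `hi'`. The bound is stated for all trees so that it applies to the child.
  have key : ∀ n, ∀ I : VTree ifs V, I.cantorMeasure {c} ≤ ENNReal.ofReal hi' ^ n := by
    intro n
    induction n with
    | zero =>
      intro I
      rw [pow_zero]
      exact (measure_mono (subset_univ _)).trans (I.cantorMeasure_univ_le hab hhi hr)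
    | succ n ih =>
      intro I
      rw [I.cantorMeasure_eq_sum hab hhi hr, Measure.finsetSum_apply,
        Finset.sum_eq_single_of_mem (e I) (Finset.mem_univ _)]
      · rw [Measure.smul_apply, smul_eq_mul, pow_succ', Measure.map_apply
          (I.sys.continuous_map _).measurable (measurableSet_singleton c)]
        have : I.sys.map (e I) ⁻¹' {c} = {c} := by
          ext x
          rw [mem_preimage, mem_singleton_iff, mem_singleton_iff]
          nth_rewrite 1 [← he I]
          exact (I.sys.map_strictMono _).injective.eq_iff
        rw [this]
        exact mul_le_mul' (ENNReal.ofReal_le_ofReal (hm _ _)) (ih _)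
      · intro i _ h
        rw [Measure.smul_apply, smul_eq_mul, Measure.map_apply
          (I.sys.continuous_map _).measurable (measurableSet_singleton c)]
        have : I.sys.map i ⁻¹' {c} ⊆ (Icc a b)ᶜ := fun x hx hx' => hne I i h x hx' hx
        rw [measure_mono_null this ((I.child i).cantorMeasure_compl_Icc hab hhi hr), mul_zero]
  have hlt : ENNReal.ofReal hi' < 1 := by simpa using hhi'
  exact le_antisymm (ge_of_tendsto' (ENNReal.tendsto_pow_atTop_nhds_zero_of_lt_one hlt)
    fun n => key n I) zero_le

/-- Elements of `H¹` are unconstrained at `a` and `b`, so these points must be null. Only the first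
map reaches `a` from `[a, b]`, and only the last reaches `b`. -/
theorem ae_mem_Ioo_cantorMeasure (hab : a < b) {hi hi' : ℝ} (hhi : hi < 1)
    (hr : ∀ j i, (ifs j).r i ≤ hi) (hhi' : hi' < 1) (hm : ∀ j i, (ifs j).m i ≤ hi')
    (I : VTree ifs V) : ∀ᵐ x ∂I.cantorMeasure, x ∈ Ioo a b := by
  have h1 : ∀ᵐ x ∂I.cantorMeasure, x ∈ Icc a b := I.cantorMeasure_compl_Icc hab hhi hr
  have h2 : ∀ᵐ x ∂I.cantorMeasure, x ≠ a := compl_mem_ae_iff.2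
    (cantorMeasure_singleton_eq_zero hab hhi hr hhi' hm (fun I : VTree ifs V => I.sys.first)
      (fun I => I.sys.map_first) (fun I i hi x hx => ((I.sys.lt_map_left hab i hi).trans_le
        ((I.sys.map_strictMono i).monotone hx.1)).ne') I)
  have h3 : ∀ᵐ x ∂I.cantorMeasure, x ≠ b := compl_mem_ae_iff.2
    (cantorMeasure_singleton_eq_zero hab hhi hr hhi' hm (fun I : VTree ifs V => I.sys.last)
      (fun I => I.sys.map_last) (fun I i hi x hx => (((I.sys.map_strictMono i).monotone
        hx.2).trans_lt (I.sys.map_right_lt hab i hi)).ne) I)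
  filter_upwards [h1, h2, h3] with x h1 h2 h3
  exact ⟨lt_of_le_of_ne h1.1 (Ne.symm h2), lt_of_le_of_ne h1.2 h3⟩

/-! ### Decomposition along a cut -/

theorem IsCut.cantorMeasure_eq_finsum (hab : a < b) {hi : ℝ} (hhi : hi < 1)
    (hr : ∀ j i, (ifs j).r i ≤ hi) {I : VTree ifs V} {Λ : Set (Node I)} (h : IsCut Λ) :
    I.cantorMeasure =
      ∑ᶠ w ∈ Λ, ENNReal.ofReal w.weight • w.subtree.cantorMeasure.map w.map := by
  induction h with
  | root I =>
    rw [finsum_mem_singleton, Node.weight, ENNReal.ofReal_one, one_smul, Node.map, Measure.map_id,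
      Node.subtree]
  | @branch I Λ h ih =>
    rw [finsum_mem_iUnion, finsum_eq_sum_of_fintype, I.cantorMeasure_eq_sum hab hhi hr]
    · refine Finset.sum_congr rfl fun i _ => ?_
      rw [finsum_mem_image fun w _ w' _ hw => by simpa using hw, ih i,
        ← Measure.mapₗ_apply_of_measurable (I.sys.continuous_map i).measurable]
      -- Pushing forward by `S_i` and scaling by `m_i` is additive, hence commutes with the sum over
      -- the finite cut of the child.
      have := AddMonoidHom.map_finsum_mem (fun w : Node (I.child i) =>
        ENNReal.ofReal w.weight • w.subtree.cantorMeasure.map w.map)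
        (ENNReal.ofReal (I.sys.m i) • Measure.mapₗ (I.sys.map i)).toAddMonoidHom (h i).finite
      refine this.trans (finsum_mem_congr rfl fun w _ => ?_)
      simp only [LinearMap.toAddMonoidHom_coe, LinearMap.smul_apply, map_smul]
      rw [Measure.mapₗ_apply_of_measurable (I.sys.continuous_map i).measurable, Measure.map_map
        (I.sys.continuous_map i).measurable w.continuous_map.measurable, smul_smul, Node.weight,
        ENNReal.ofReal_mul (I.sys.m_pos i).le, mul_comm]
      rfl
    · intro i j hij
      refine disjoint_left.2 ?_
      rintro _ ⟨w, -, rfl⟩ ⟨w', -, hw⟩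
      simp only [Node.cons.injEq] at hw
      exact hij hw.1.symm
    · exact fun i => (h i).finite.image _

/-- The counting function of a form decoupled along a cut of the tree. -/
theorem IsCut.formCount_eq_tsum (hab : a < b) {hi hi' : ℝ} (hhi : hi < 1)
    (hr : ∀ j i, (ifs j).r i ≤ hi) (hhi' : hi' < 1) (hm : ∀ j i, (ifs j).m i ≤ hi')
    {I : VTree ifs V} {Λ : Set (Node I)} (h : IsCut Λ) (x : ℝ) :
    formCount (decoupledDomain Λ) (decoupledForm Λ) I.cantorMeasure x =
      ∑' w : Λ, w.1.subtree.neumannCount (w.1.scale * w.1.weight * x) := by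
  have : Fintype Λ := h.finite.fintype
  have hsub : ∀ w : Node I, w.map '' Ioo a b ⊆ Ioo (w.map a) (w.map b) := by
    rintro w _ ⟨y, hy, rfl⟩
    exact ⟨w.map_strictMono hy.1, w.map_strictMono hy.2⟩
  have hgap : ∀ w w' : Node I, w ∈ Λ → w' ∈ Λ →
      Disjoint (Ioo (w.map b) (nextLeft Λ w)) (w'.map '' Ioo a b) := by
    intro w w' hw hw'
    refine (disjoint_left.2 fun y hy hy' => ?_ :
      Disjoint _ (Ioo (w'.map a) (w'.map b))).mono_right (hsub w')
    by_cases hne : w' = w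
    · subst hne
      exact lt_asymm hy.1 hy'.2
    rcases h.ordered hab w' hw' w hw hne with h1 | h1
    · exact absurd (hy'.2.trans_le h1) (not_lt.2 ((w.map_strictMono hab).trans hy.1).le)
    -- The set defining `nextLeft` is bounded below by `w.map b`, so its infimum is at most the left
    -- end of any cell to the right.
    · have : nextLeft Λ w ≤ w'.map a :=
        csInf_le ⟨w.map b, fun z ⟨_, _, _, hz⟩ => hz⟩ ⟨w', hw', rfl, h1⟩
      exact absurd (hy.2.trans_le this) (not_lt.2 hy'.1.le)
  have key := formCount_decoupled_eq_sum (ι := Λ) (κ := {w : Node I // w ∈ Λ ∧ ¬ w.IsLast})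
    (S := fun w => w.1.map) (a := a) (b := b) (u := fun w => w.1.map b)
    (v := fun w => nextLeft Λ w.1) (μ := I.cantorMeasure)
    (ν := fun w => w.1.subtree.cantorMeasure) (p := fun w => w.1.weight) (r := fun w => w.1.scale)
    (fun w => w.1.measurableEmbedding_map)
    (fun w w' hne => (h.ordered hab w w.2 w' w'.2 (Subtype.coe_ne_coe.2 hne)).elim
      (fun h1 => (Ioo_disjoint_Ioo.2 ((min_le_left _ _).trans (h1.trans (le_max_right _ _)))).mono
        (hsub w) (hsub w'))
      (fun h1 => (Ioo_disjoint_Ioo.2 ((min_le_right _ _).trans (h1.trans (le_max_left _ _)))).mono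
        (hsub w) (hsub w')))
    (fun w w' => hgap w w' w.2.1 w'.2)
    (fun w => w.1.subtree.ae_mem_Ioo_cantorMeasure hab hhi hr hhi' hm)
    (fun w => w.1.weight_pos) (fun w => w.1.scale_pos)
    (by rw [h.cantorMeasure_eq_finsum hab hhi hr, ← finsum_set_coe_eq_finsum_mem,
      finsum_eq_sum_of_fintype]) x
  rw [tsum_fintype]
  refine Eq.trans ?_ key
  congr 1
  · ext f
    simp [decoupledDomain]
  · funext f g
    rw [decoupledForm, tsum_fintype]

end VTree

theorem proposition4p6 {J : Type*} {a b : ℝ} (hab : a < b) (ifs : J → WeightedIFS a b)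
    (hC1 : BddAbove (Set.range fun j => (ifs j).N))
    (hC2 : ∃ lo hi : ℝ, 0 < lo ∧ hi < 1 ∧ ∀ j i, lo ≤ (ifs j).m i ∧ (ifs j).m i ≤ hi)
    (hC3 : ∃ lo hi : ℝ, 0 < lo ∧ hi < 1 ∧ ∀ j i, lo ≤ (ifs j).r i ∧ (ifs j).r i ≤ hi)
    {V : ℕ} (I : VTree ifs V) (hneck : {n : ℕ | (I.env n).IsNeck}.Infinite)
    (k : ℕ) (x : ℝ) (hx : 0 ≤ x) :
    I.decoupledCount k x =
      ∑' w : I.cutSet k, w.1.subtree.neumannCount (w.1.scale * w.1.weight * x) := by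
  obtain ⟨_, hi', -, hhi', hm⟩ := hC2
  obtain ⟨_, hi, -, hhi, hr⟩ := hC3
  exact (VTree.isCut_cutSet hhi' (fun j i => (hm j i).2) hneck k).formCount_eq_tsum hab hhi
    (fun j i => (hr j i).2) hhi' (fun j i => (hm j i).2) x
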